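/- Let $R$ be a commutative Noetherian local Cohen--Macaulay ring of dimension $1$ with total ring of fractions $Q(R)$, and assume that $R$ is generically Gorenstein, i.e. $R_{\mathfrak p}$ is Gorenstein for every associated prime $\mathfrak p$ of $R$. Let $R\subseteq S\subseteq Q(R)$ be a ring extension such that $S$ is finitely generated as an $R$-module, and assume that $S$ is a Gorenstein ring. Let $\operatorname{CM}(S)$ be the class of maximal Cohen--Macaulay $S$-modules, that is, finitely generated $S$-modules $M$ with $\operatorname{depth} M_{\mathfrak n}\ge\dim S_{\mathfrak n}$ for all maximal ideals $\mathfrak n$ of $S$ (where $\operatorname{depth} 0=\infty$), regarded as $R$-modules by restriction of scalars. Let $\operatorname{refl}(R)$ be the class of finitely generated reflexive $R$-modules. For an $R$-module $M$ let $\operatorname{tr}_R(M)=\sum_{f\in\operatorname{Hom}_R(M,R)}f(M)$ be its trace ideal, and let $\mathfrak c_R(S)=\{a\in Q(R): aS\subseteq R\}$ be the conductor, which is an ideal of $R$. An ideal $I$ of $R$ is called stable if it contains a non-zero-divisor of $R$ and $I\cong\operatorname{Hom}_R(I,I)$ as $R$-modules. Then the following are equivalent: \begin{enumerate} \item $\operatorname{CM}(S)\subseteq\operatorname{refl}(R)$;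 \item $S\cong\operatorname{Hom}_R(S,R)$ as $R$-modules; \item $S\in\operatorname{refl}(R)$, and $\mathfrak c_R(S)$ is a stable ideal of $R$; \item $\operatorname{CM}(S)=\{M\in\operatorname{refl}(R): \operatorname{tr}_R(M)\subseteq\mathfrak c_R(S)\}$. \end{enumerate} -/

import Mathlib

universe u

namespace BirationalExt

/-- The depth of a module over a local ring: the supremum of the lengths of sequences in the
maximal ideal that are weakly regular on `M`. For a nonzero finitely generated module over a
Noetherian local ring, weakly regular sequences in the maximal ideal are regular, by Nakayama,
so this is the usual depth; the zero module has depth `⊤`. -/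
noncomputable def depth (A : Type*) [CommRing A] [IsLocalRing A]
    (M : Type*) [AddCommGroup M] [Module A M] : ℕ∞ :=
  ⨆ (rs : List A) (_ : ∀ r ∈ rs, r ∈ IsLocalRing.maximalIdeal A)
    (_ : RingTheory.Sequence.IsWeaklyRegular M rs), (rs.length : ℕ∞)

/-- A Cohen-Macaulay local ring. -/
def IsCohenMacaulayLocalRing (A : Type*) [CommRing A] [IsLocalRing A] : Prop :=
  IsNoetherianRing A ∧ ((depth A A : ℕ∞) : WithBot ℕ∞) = ringKrullDim A

/-- A Gorenstein local ring: Noetherian and of finite injective dimension over itself. -/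
def IsGorensteinLocalRing (A : Type u) [CommRing A] [IsLocalRing A] : Prop :=
  IsNoetherianRing A ∧
    ∃ n : ℕ, CategoryTheory.HasInjectiveDimensionLE (ModuleCat.of A A) n

/-- A Gorenstein ring: Noetherian, and every localization at a maximal ideal is Gorenstein. -/
def IsGorensteinRing (A : Type u) [CommRing A] : Prop :=
  IsNoetherianRing A ∧
    ∀ (m : Ideal A) [m.IsMaximal], IsGorensteinLocalRing (Localization.AtPrime m)

/-- Every localization at an associated prime is Gorenstein. -/
def IsGenericallyGorenstein (A : Type u) [CommRing A] : Prop :=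
  ∀ (p : Ideal A) [p.IsPrime], p ∈ associatedPrimes A A →
    IsGorensteinLocalRing (Localization.AtPrime p)

/-- Maximal Cohen-Macaulay modules: finitely generated `M` with
`depth M_m ≥ dim A_m` for every maximal ideal `m` (the zero module is included). -/
def IsMCM (A : Type*) [CommRing A] (M : Type*) [AddCommGroup M] [Module A M] : Prop :=
  Module.Finite A M ∧
    ∀ (m : Ideal A) [m.IsMaximal],
      ringKrullDim (Localization.AtPrime m) ≤
        ((depth (Localization.AtPrime m) (LocalizedModule m.primeCompl M) : ℕ∞) : WithBot ℕ∞)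

/-- The `R`-module `M` belongs to `CM(S)`: its `R`-module structure is the restriction of
a maximal Cohen-Macaulay `S`-module structure. -/
def MemCM (R : Type*) [CommRing R] (S : Type*) [CommRing S] [Algebra R S]
    (M : Type*) [AddCommGroup M] [Module R M] : Prop :=
  ∃ _ : Module S M, IsScalarTower R S M ∧ IsMCM S M

/-- The `R`-module `M` belongs to `refl(R)`: it is finitely generated and reflexive. -/
def MemRefl (R : Type*) [CommRing R] (M : Type*) [AddCommGroup M] [Module R M] : Prop :=
  Module.Finite R M ∧ Module.IsReflexive R M

/-- The trace ideal of `M`: the sum of the images of all linear maps `M → R`. -/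
def traceIdeal (R : Type*) [CommRing R] (M : Type*) [AddCommGroup M] [Module R M] : Ideal R :=
  ⨆ f : M →ₗ[R] R, LinearMap.range f

/-- The conductor `(R :_Q S)`, viewed as an ideal of `R` (it lies in `R` because `1 ∈ S`). -/
def conductor {R : Type*} [CommRing R] {Q : Type*} [CommRing Q] [Algebra R Q]
    (S : Subalgebra R Q) : Ideal R :=
  ((1 : Submodule R Q) / Subalgebra.toSubmodule S).comap (Algebra.linearMap R Q)

/-- A stable ideal: an ideal that contains a non-zero-divisor and is isomorphic to its
endomorphism module. -/
def IsStable {R : Type*} [CommRing R] (I : Ideal R) : Prop :=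
  (∃ x ∈ I, x ∈ nonZeroDivisors R) ∧ Nonempty (I ≃ₗ[R] (I →ₗ[R] I))

end BirationalExt

/-! Write `c` for the conductor. Since `R` has dimension one and a regular element `x` in its
maximal ideal, `CM(S)` consists of the finite `S`-modules that are torsion-free over `R`
(`isMCM_iff_isTorsionFree`). The Gorenstein ring `S` is semilocal of dimension one, so it has finite
self-injective dimension; then `Ext²(-, S)` vanishes on finite modules, `Ext¹(-, S)` vanishes on
torsion-free ones, and these are reflexive over `S` (`isReflexive_of_isTorsionFree`).

Everything else compares `R`-duals with `S`-duals. Evaluation at `1` gives `Hom_R(S, R) ≅ c`, and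
`End_R(c) ≅ S` once `S` is `R`-reflexive; hence 2 ⇔ 3. If `S ≅ Hom_R(S, R)`, every `R`-functional on
an `S`-module factors uniquely through `S`, so `S`-reflexive implies `R`-reflexive; hence 2 ⇒ 1.

For 1 ⇒ 2, apply both reflexivities to fractional ideals of `S`. They force `c · (S : c) = S`, and
an invertible ideal of a semilocal ring is principal, so `c ≅ S` (`exists_conductor_generator`).

For 1 ⇒ 4, functionals on an `S`-module take values in `c`; conversely, if a reflexive `M` has trace
in `c`, then `f ↦ s * f m` is again `R`-valued, and biduality turns it into an element `s • m`. -/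

namespace BirationalExt

/-! ### Dimension shifting and Nakayama for `Ext`. -/

section ExtVanishing

open CategoryTheory Abelian Module

variable {A : Type u} [CommRing A]

/-- A linear map on the kernel of a short exact sequence `0 → K → F → M → 0` extends to `F` when
`Ext¹(M, B) = 0`. -/
theorem exists_extension_of_subsingleton_ext {K F M B : Type u} [AddCommGroup K] [Module A K]
    [AddCommGroup F] [Module A F] [AddCommGroup M] [Module A M] [AddCommGroup B] [Module A B]
    {i : K →ₗ[A] F} {p : F →ₗ[A] M} (hi : Function.Injective i) (hp : Function.Surjective p)
    (hip : Function.Exact i p)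
    (h : Subsingleton (Ext (ModuleCat.of A M) (ModuleCat.of A B) 1)) (g : K →ₗ[A] B) :
    ∃ G : F →ₗ[A] B, G ∘ₗ i = g := by
  let T := ModuleCat.shortComplexOfCompEqZero i p hip.linearMap_comp_eq_zero
  have hT : T.ShortExact := ModuleCat.shortComplex_shortExact T hip hi hp
  obtain ⟨φ, hφ⟩ := Ext.contravariant_sequence_exact₁ hT (ModuleCat.of A B)
    (Ext.mk₀ (ModuleCat.ofHom g)) (add_zero 1) (Subsingleton.elim (α := Ext _ _ _) _ _)
  obtain ⟨φ, rfl⟩ := Ext.homEquiv₀.symm.surjective φ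
  have : T.f ≫ φ = ModuleCat.ofHom g := Ext.homEquiv₀.symm.injective (by simpa using hφ)
  exact ⟨φ.hom, congrArg ModuleCat.Hom.hom this⟩

theorem subsingleton_ext_of_exact {N₁ N₂ N₃ : Type u} [AddCommGroup N₁] [Module A N₁]
    [AddCommGroup N₂] [Module A N₂] [AddCommGroup N₃] [Module A N₃] {B : ModuleCat.{u} A}
    {f : N₁ →ₗ[A] N₂} {g : N₂ →ₗ[A] N₃} (hf : Function.Injective f) (hg : Function.Surjective g)
    (hfg : Function.Exact f g) {r : ℕ} (h₁ : Subsingleton (Ext (ModuleCat.of A N₁) B r))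
    (h₃ : Subsingleton (Ext (ModuleCat.of A N₃) B r)) :
    Subsingleton (Ext (ModuleCat.of A N₂) B r) := by
  let T := ModuleCat.shortComplexOfCompEqZero f g hfg.linearMap_comp_eq_zero
  have hT : T.ShortExact := ModuleCat.shortComplex_shortExact T hfg hf hg
  refine subsingleton_of_forall_eq 0 fun e => ?_
  obtain ⟨e', rfl⟩ := Ext.contravariant_sequence_exact₂ hT B e (h₁.elim _ _)
  rw [h₃.elim e' 0, Ext.comp_zero]

theorem subsingleton_ext_of_injective {N₁ N₂ : Type u} [AddCommGroup N₁] [Module A N₁]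
    [AddCommGroup N₂] [Module A N₂] {B : ModuleCat.{u} A}
    {f : N₁ →ₗ[A] N₂} (hf : Function.Injective f) {r : ℕ}
    (h₂ : Subsingleton (Ext (ModuleCat.of A N₂) B r))
    (h₃ : Subsingleton (Ext (ModuleCat.of A (N₂ ⧸ LinearMap.range f)) B (r + 1))) :
    Subsingleton (Ext (ModuleCat.of A N₁) B r) := by
  let T := ModuleCat.shortComplexOfCompEqZero f (LinearMap.range f).mkQ
    f.exact_map_mkQ_range.linearMap_comp_eq_zero
  have hT : T.ShortExact := ModuleCat.shortComplex_shortExact T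
    f.exact_map_mkQ_range hf (Submodule.mkQ_surjective _)
  refine subsingleton_of_forall_eq 0 fun e => ?_
  obtain ⟨e', rfl⟩ := Ext.contravariant_sequence_exact₁ hT B e (add_comm 1 r) (h₃.elim _ _)
  rw [h₂.elim e' 0, Ext.comp_zero]

theorem subsingleton_ext_of_linearEquiv {N₁ N₂ : Type u} [AddCommGroup N₁] [Module A N₁]
    [AddCommGroup N₂] [Module A N₂] {B : ModuleCat.{u} A} (e : N₁ ≃ₗ[A] N₂) {r : ℕ}
    (h : Subsingleton (Ext (ModuleCat.of A N₂) B r)) :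
    Subsingleton (Ext (ModuleCat.of A N₁) B r) := by
  refine subsingleton_of_forall_eq 0 fun a => ?_
  have : a = (Ext.mk₀ e.toModuleIso.hom).comp ((Ext.mk₀ e.toModuleIso.inv).comp a (zero_add r))
      (zero_add r) := by
    rw [Ext.mk₀_comp_mk₀_assoc, Iso.hom_inv_id, Ext.mk₀_id_comp]
  rw [this, h.elim ((Ext.mk₀ e.toModuleIso.inv).comp a (zero_add r)) 0, Ext.comp_zero]

/-- Multiplication by `x` resolves `A / x` by two free modules, so its projective dimension is at
most one. -/
theorem subsingleton_ext_quotSMulTop (B : ModuleCat.{u} A) {x : A} (hx : x ∈ nonZeroDivisors A)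
    (r : ℕ) : Subsingleton (Ext (ModuleCat.of A (QuotSMulTop x A)) B (r + 2)) := by
  have hreg : IsSMulRegular (ModuleCat.of A A) x := fun a b hab =>
    (mul_cancel_left_mem_nonZeroDivisors hx).mp hab
  have hproj : Projective (ModuleCat.of A A) :=
    (IsProjective.iff_projective (R := A) A).mp inferInstance
  refine subsingleton_of_forall_eq 0 fun e => ?_
  obtain ⟨e', rfl⟩ := Ext.contravariant_sequence_exact₃ hreg.smulShortComplex_shortExact B
    (n₁ := r + 2) e (Ext.eq_zero_of_projective (P := ModuleCat.of A A) _)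
    (add_comm 1 (r + 1))
  have he : e' = 0 := Ext.eq_zero_of_projective (P := ModuleCat.of A A) e'
  rw [he]
  exact Ext.comp_zero _ _ _ _ _

/-- Nakayama's lemma for `Ext`, along multiplication by an `M`-regular element of the Jacobson
radical. -/
theorem subsingleton_ext_of_isSMulRegular [IsNoetherianRing A] {M : Type u} [AddCommGroup M]
    [Module A M] [Module.Finite A M] (B : ModuleCat.{u} A) [Module.Finite A B] {x : A}
    (hxJ : x ∈ Ideal.jacobson (⊥ : Ideal A)) (hxM : IsSMulRegular M x) {r : ℕ}
    (h : Subsingleton (Ext (ModuleCat.of A (QuotSMulTop x M)) B (r + 1))) :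
    Subsingleton (Ext (ModuleCat.of A M) B r) := by
  have hreg : IsSMulRegular (ModuleCat.of A M) x := hxM
  have key : (⊤ : Submodule A (Ext (ModuleCat.of A M) B r)) = ⊥ := by
    refine Submodule.eq_bot_of_le_smul_of_le_jacobson_bot (Ideal.span {x}) _
      Module.Finite.fg_top (fun e _ => ?_) ((Ideal.span_singleton_le_iff_mem _).mpr hxJ)
    obtain ⟨e', rfl⟩ := Ext.contravariant_sequence_exact₁ hreg.smulShortComplex_shortExact B e
      (add_comm 1 r) (h.elim _ _)
    have hsmul (a : Ext (ModuleCat.of A M) B r) :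
        (Ext.mk₀ (x • 𝟙 (ModuleCat.of A M))).comp a (zero_add r) = x • a := by
      rw [Ext.mk₀_smul, Ext.smul_comp, Ext.mk₀_id_comp]
    refine (hsmul e').symm ▸ ?_
    exact Submodule.smul_mem_smul (Ideal.mem_span_singleton_self x) trivial
  exact (Submodule.subsingleton_iff A).mp (subsingleton_iff_bot_eq_top.mp key.symm)

end ExtVanishing

/-! ### Finite self-injective dimension and reflexivity. -/

section Reflexive

open CategoryTheory Abelian Module

variable {A : Type u} [CommRing A] [IsNoetherianRing A] {x : A}

/-- Prime filtrations reduce to `N = A / p`. If `x ∈ p`, then `p` is maximal and `A / p` embeds in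
`A / x`, of projective dimension at most one; otherwise `x` is regular on `A / p` and Nakayama
applies. Either way the next `Ext` group controls this one. -/
theorem subsingleton_ext_of_subsingleton_ext_succ (hx : x ∈ nonZeroDivisors A)
    (hxJ : x ∈ Ideal.jacobson (⊥ : Ideal A))
    (hxm : ∀ p : Ideal A, p.IsPrime → x ∈ p → p.IsMaximal) (B : ModuleCat.{u} A)
    [Module.Finite A B] {r : ℕ}
    (h : ∀ (N : Type u) [AddCommGroup N] [Module A N] [Module.Finite A N],
      Subsingleton (Ext (ModuleCat.of A N) B (r + 3)))
    (N : Type u) [AddCommGroup N] [Module A N] [hN : Module.Finite A N] :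
    Subsingleton (Ext (ModuleCat.of A N) B (r + 2)) := by
  induction hN using IsNoetherianRing.induction_on_isQuotientEquivQuotientPrime A with
  | subsingleton N =>
    refine subsingleton_ext_of_injective (f := (0 : N →ₗ[A] A))
      (Function.injective_of_subsingleton _) ?_ (h _)
    have : Projective (ModuleCat.of A A) :=
      (IsProjective.iff_projective (R := A) A).mp inferInstance
    exact subsingleton_of_forall_eq 0 fun e => Ext.eq_zero_of_projective e
  | quotient N p e =>
    refine subsingleton_ext_of_linearEquiv e ?_
    by_cases hp : x ∈ p.1
    -- A minimal prime over the annihilator of `A / x` is associated to `A / x`, which gives the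
    -- embedding.
    · have hmin : p.1 ∈ (annihilator A (QuotSMulTop x A)).minimalPrimes := by
        have hann : x ∈ annihilator A (QuotSMulTop x A) := QuotSMulTop.mem_annihilator A x
        refine ⟨⟨p.2, fun a ha => ?_⟩, fun q hq hqp => ?_⟩
        · have := (mem_annihilator.mp ha) (Submodule.Quotient.mk 1)
          rw [← Submodule.Quotient.mk_smul, Submodule.Quotient.mk_eq_zero,
            Submodule.mem_smul_pointwise_iff_exists] at this
          obtain ⟨b, -, hb⟩ := this
          have : a = x * b := by simpa using hb.symm
          exact this ▸ p.1.mul_mem_right b hp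
        · exact ((hxm q hq.1 (hq.2 hann)).eq_of_le p.2.ne_top hqp).ge
      obtain ⟨-, f, hf⟩ := (isAssociatedPrime_iff_exists_injective_linearMap _ _).mp
        (Module.associatedPrimes.minimalPrimes_annihilator_subset_associatedPrimes A (QuotSMulTop x A) hmin)
      exact subsingleton_ext_of_injective hf (subsingleton_ext_quotSMulTop B hx r) (h _)
    · refine subsingleton_ext_of_isSMulRegular B hxJ ?_ (h _)
      refine (isSMulRegular_iff_right_eq_zero_of_smul (R := A)).mpr fun a ha => ?_
      obtain ⟨a, rfl⟩ := Ideal.Quotient.mk_surjective a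
      rw [← Ideal.Quotient.mk_eq_mk, ← Submodule.Quotient.mk_smul, Ideal.Quotient.mk_eq_mk,
        Ideal.Quotient.eq_zero_iff_mem] at ha
      exact Ideal.Quotient.eq_zero_iff_mem.mpr ((p.2.mem_or_mem ha).resolve_left hp)
  | exact N₁ N₂ N₃ f g hf hg hfg h₁ h₃ => exact subsingleton_ext_of_exact hf hg hfg h₁ h₃

theorem subsingleton_ext_two (hx : x ∈ nonZeroDivisors A)
    (hxJ : x ∈ Ideal.jacobson (⊥ : Ideal A))
    (hxm : ∀ p : Ideal A, p.IsPrime → x ∈ p → p.IsMaximal) (B : ModuleCat.{u} A)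
    [Module.Finite A B] {n : ℕ} (hB : HasInjectiveDimensionLE B n)
    (N : Type u) [AddCommGroup N] [Module A N] [Module.Finite A N] :
    Subsingleton (Ext (ModuleCat.of A N) B 2) := by
  -- Descending induction on the degree, from `n + 2`; truncated subtraction stops it at `2`.
  have key : ∀ k : ℕ, ∀ (N : Type u) [AddCommGroup N] [Module A N] [Module.Finite A N],
      Subsingleton (Ext (ModuleCat.of A N) B (n - k + 2)) := by
    intro k
    induction k with
    | zero =>
      intro N _ _ _
      exact HasInjectiveDimensionLT.subsingleton B (n + 1) _ (by omega) _
    | succ k ih =>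
      by_cases hk : n ≤ k
      · rw [Nat.sub_eq_zero_of_le hk] at ih
        rwa [Nat.sub_eq_zero_of_le (hk.trans k.le_succ)]
      · have h₁ : n - k + 2 = n - (k + 1) + 3 := by omega
        rw [h₁] at ih
        exact subsingleton_ext_of_subsingleton_ext_succ hx hxJ hxm B ih
  simpa using key n N

/-- Over a Noetherian ring of finite self-injective dimension, with a regular element `x` in the
Jacobson radical such that `A / x` is zero-dimensional, every finite `x`-regular module is
reflexive. -/
theorem isReflexive_of_isSMulRegular (hx : x ∈ nonZeroDivisors A)
    (hxJ : x ∈ Ideal.jacobson (⊥ : Ideal A))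
    (hxm : ∀ p : Ideal A, p.IsPrime → x ∈ p → p.IsMaximal) {n : ℕ}
    (hA : HasInjectiveDimensionLE (ModuleCat.of A A) n)
    (M : Type u) [AddCommGroup M] [Module A M] [Module.Finite A M] (hM : IsSMulRegular M x) :
    IsReflexive A M := by
  have hAx : IsSMulRegular A x := fun a b hab =>
    (mul_cancel_left_mem_nonZeroDivisors hx).mp hab
  have ext₁ (M : Type u) [AddCommGroup M] [Module A M] [Module.Finite A M]
      (hM : IsSMulRegular M x) : Subsingleton (Ext (ModuleCat.of A M) (ModuleCat.of A A) 1) :=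
    subsingleton_ext_of_isSMulRegular _ hxJ hM (subsingleton_ext_two hx hxJ hxm _ hA _)
  have hdual (M : Type u) [AddCommGroup M] [Module A M] : IsSMulRegular (Dual A M) x :=
    fun f g hfg => LinearMap.ext fun m => hAx (LinearMap.congr_fun hfg m)
  -- With `K = ker p` and `F` free, `restrict` and `exact'` say that `0 → M* → F* → K* → 0` is
  -- exact.
  have restrict (M : Type u) [AddCommGroup M] [Module A M] [Module.Finite A M]
      (hM : IsSMulRegular M x) {k : ℕ} (p : (Fin k → A) →ₗ[A] M) (hp : Function.Surjective p) :
      Function.Surjective (LinearMap.ker p).subtype.dualMap := fun g =>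
    exists_extension_of_subsingleton_ext (Submodule.injective_subtype _) hp
      (LinearMap.exact_subtype_ker_map p) (ext₁ M hM) g
  have exact' (M : Type u) [AddCommGroup M] [Module A M] {k : ℕ}
      (p : (Fin k → A) →ₗ[A] M) (hp : Function.Surjective p) :
      Function.Exact p.dualMap (LinearMap.ker p).subtype.dualMap := by
    intro g
    constructor
    · intro hg
      obtain ⟨s, hs⟩ := hp.hasRightInverse
      have hker (a b : Fin k → A) (hab : p a = p b) : g a = g b := by
        have : a - b ∈ LinearMap.ker p := by simp [hab]
        have := LinearMap.congr_fun hg ⟨a - b, this⟩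
        simpa [sub_eq_zero] using this
      refine ⟨{ toFun := fun m => g (s m)
                map_add' := fun a b => ?_
                map_smul' := fun a b => ?_ }, ?_⟩
      · rw [← map_add]; exact hker _ _ (by simp [hs _])
      · rw [RingHom.id_apply, ← map_smul]; exact hker _ _ (by simp [hs _])
      · ext1; exact LinearMap.ext fun a => hker _ _ (hs _)
    · rintro ⟨h, rfl⟩
      ext a
      simp
  have surj (M : Type u) [AddCommGroup M] [Module A M] [Module.Finite A M]
      (hM : IsSMulRegular M x) : Function.Surjective (Dual.eval A M) := by
    obtain ⟨k, p, hp⟩ := Module.Finite.exists_fin' A M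
    intro Φ
    -- `K*` is also `x`-regular, so dualizing once more extends `Φ` from `M*` to `F*`, where it is
    -- evaluation at a vector.
    obtain ⟨Ψ, hΨ⟩ := exists_extension_of_subsingleton_ext
      (LinearMap.dualMap_injective_of_surjective hp) (restrict M hM p hp) (exact' M p hp)
      (ext₁ _ (hdual _)) Φ
    obtain ⟨a, rfl⟩ := (bijective_dual_eval A (Fin k → A)).2 Ψ
    refine ⟨p a, LinearMap.ext fun h => ?_⟩
    rw [← hΨ]
    rfl
  refine ⟨⟨?_, surj M hM⟩⟩
  rw [injective_iff_map_eq_zero]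
  intro m hm
  obtain ⟨k, p, hp⟩ := Module.Finite.exists_fin' A M
  obtain ⟨a, rfl⟩ := hp m
  have hfac : ∀ g : Dual A (Fin k → A), (LinearMap.ker p).subtype.dualMap g = 0 → g a = 0 := by
    intro g hg
    obtain ⟨h, rfl⟩ := (exact' M p hp g).mp hg
    exact LinearMap.congr_fun hm h
  obtain ⟨s, hs⟩ := (restrict M hM p hp).hasRightInverse
  have hker (g h : Dual A (Fin k → A)) (hgh : (LinearMap.ker p).subtype.dualMap g =
      (LinearMap.ker p).subtype.dualMap h) : g a = h a := by
    rw [← sub_eq_zero, ← LinearMap.sub_apply]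
    exact hfac _ (by rw [map_sub, hgh, sub_self])
  -- Evaluation at `a` kills the functionals vanishing on `K`, so it descends to `K*`. Surjectivity
  -- of biduality for `K` then produces `b ∈ K` with the same evaluations as `a`.
  let Θ : Dual A (Dual A (LinearMap.ker p)) :=
    { toFun := fun g => s g a
      map_add' := fun g h => by
        rw [← LinearMap.add_apply]; exact hker _ _ (by simp only [map_add, hs _])
      map_smul' := fun c g => by
        rw [RingHom.id_apply, ← LinearMap.smul_apply]
        exact hker _ _ (by simp only [map_smul, hs _]) }
  obtain ⟨b, hb⟩ := surj (LinearMap.ker p)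
    (fun u v huv => Subtype.ext <| funext fun j => hAx <| congrFun (congrArg Subtype.val huv) j) Θ
  have hab : a = b.1 := by
    refine (bijective_dual_eval A (Fin k → A)).1 (LinearMap.ext fun g => ?_)
    have h₁ : s ((LinearMap.ker p).subtype.dualMap g) a = g a := hker _ _ (hs _)
    have h₂ := LinearMap.congr_fun hb ((LinearMap.ker p).subtype.dualMap g)
    exact h₁.symm.trans h₂.symm
  rw [hab]
  exact b.2

end Reflexive

/-! ### Semilocal rings of dimension one and their maximal Cohen–Macaulay modules. -/

section OneDimensional

open CategoryTheory Abelian Module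

variable {A : Type u} [CommRing A] [IsNoetherianRing A] {x : A}

/-- The maximal ideals are all minimal over `(x)`. -/
theorem finite_setOf_isMaximal (hxJ : x ∈ Ideal.jacobson (⊥ : Ideal A))
    (hxm : ∀ p : Ideal A, p.IsPrime → x ∈ p → p.IsMaximal) :
    {m : Ideal A | m.IsMaximal}.Finite := by
  refine (Ideal.finite_minimalPrimes_of_isNoetherianRing A (Ideal.span {x})).subset ?_
  intro m hm
  have hmem (m : Ideal A) (hm : m.IsMaximal) : x ∈ m :=
    (Ideal.mem_sInf.mp hxJ) ⟨bot_le, hm⟩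
  refine ⟨⟨hm.isPrime, (Ideal.span_singleton_le_iff_mem _).mpr (hmem m hm)⟩, fun q hq hqm => ?_⟩
  exact ((hxm q hq.1 ((Ideal.span_singleton_le_iff_mem _).mp hq.2)).eq_of_le hm.ne_top hqm).ge

/-- Injective dimension is tested at maximal ideals; finitely many of them give a uniform bound. -/
theorem exists_hasInjectiveDimensionLE (hA : IsGorensteinRing A)
    (hfin : {m : Ideal A | m.IsMaximal}.Finite) :
    ∃ n : ℕ, HasInjectiveDimensionLE (ModuleCat.of A A) n := by
  have h (m : MaximalSpectrum A) : ∃ n : ℕ, HasInjectiveDimensionLE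
      ((ModuleCat.of A A).localizedModule m.1.primeCompl) n := by
    have := m.2
    obtain ⟨-, n, hn⟩ := hA.2 m.1
    refine ⟨n, (ModuleCat.hasInjectiveDimensionLE_iff_of_linearEquiv ?_ n).mp hn⟩
    let g : A →ₗ[A] (ModuleCat.of A A).localizedModule m.1.primeCompl :=
      (ModuleCat.of A A).localizedModuleMkLinearMap m.1.primeCompl
    have : IsLocalizedModule m.1.primeCompl g := ModuleCat.localizedModule_isLocalizedModule _ _
    exact LinearEquiv.extendScalarsOfIsLocalization m.1.primeCompl (Localization.AtPrime m.1)
      (IsLocalizedModule.linearEquiv m.1.primeCompl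
        (Algebra.linearMap A (Localization.AtPrime m.1)) g)
  choose n hn using h
  have : Finite (MaximalSpectrum A) := by
    have : Finite {m : Ideal A | m.IsMaximal} := hfin
    exact Finite.of_injective (fun m : MaximalSpectrum A =>
      (⟨m.1, m.2⟩ : {m : Ideal A | m.IsMaximal}))
      fun a b hab => MaximalSpectrum.ext (congrArg Subtype.val hab)
  obtain ⟨N, hN⟩ := (Set.finite_range n).bddAbove
  refine ⟨N, (ModuleCat.hasInjectiveDimensionLE_iff_forall_maximalSpectrum N _).mpr fun m => ?_⟩
  have := hn m
  exact hasInjectiveDimensionLT_of_ge _ (n m + 1) (N + 1)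
    (Nat.succ_le_succ (hN (Set.mem_range_self m)))

theorem one_le_depth_iff {B : Type*} [CommRing B] [IsLocalRing B] {M : Type*} [AddCommGroup M]
    [Module B M] :
    1 ≤ depth B M ↔ ∃ y ∈ IsLocalRing.maximalIdeal B, IsSMulRegular M y := by
  constructor
  · intro h
    by_contra! hcon
    have : depth B M ≤ 0 := by
      refine iSup_le fun rs => iSup_le fun hrs => iSup_le fun hreg => ?_
      cases rs with
      | nil => simp
      | cons y ys =>
        exact absurd ((RingTheory.Sequence.isWeaklyRegular_cons_iff M y ys).mp hreg).1
          (hcon y (hrs y (by simp)))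
    exact absurd (h.trans this) (by simp)
  · rintro ⟨y, hy, hreg⟩
    refine le_trans ?_ (le_iSup_of_le [y] (le_iSup_of_le (by simpa using hy)
      (le_iSup_of_le ?_ le_rfl)))
    · simp
    · exact (RingTheory.Sequence.isWeaklyRegular_cons_iff M y []).mpr
        ⟨hreg, RingTheory.Sequence.IsWeaklyRegular.nil _ _⟩

theorem ringKrullDim_localization_eq_one (hx : x ∈ nonZeroDivisors A)
    (hxm : ∀ p : Ideal A, p.IsPrime → x ∈ p → p.IsMaximal) (m : Ideal A) [m.IsMaximal]
    (hxmem : x ∈ m) : ringKrullDim (Localization.AtPrime m) = 1 := by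
  rw [IsLocalization.AtPrime.ringKrullDim_eq_height m]
  have hle : m.height ≤ 1 := by
    refine Ideal.height_le_one_of_isPrincipal_of_mem_minimalPrimes (Ideal.span {x}) m ?_
    refine ⟨⟨inferInstance, (Ideal.span_singleton_le_iff_mem _).mpr hxmem⟩, fun q hq hqm => ?_⟩
    exact ((hxm q hq.1 ((Ideal.span_singleton_le_iff_mem _).mp hq.2)).eq_of_le
      (Ideal.IsPrime.ne_top inferInstance) hqm).ge
  have hne : m.height ≠ 0 := by
    rw [Ne, Ideal.height_eq_zero_iff]
    intro hmin
    exact Set.disjoint_left.mp (Ideal.disjoint_nonZeroDivisors_of_mem_minimalPrimes hmin) hxmem hx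
  have : m.height = 1 := le_antisymm hle (Order.one_le_iff_ne_zero.mpr hne)
  rw [this]; rfl

/-- Each localization has dimension one, so the condition is positive depth. If `x` kills a nonzero
element, some associated prime contains `x`, hence is maximal, and the depth there is zero. -/
theorem isMCM_iff (hx : x ∈ nonZeroDivisors A) (hxJ : x ∈ Ideal.jacobson (⊥ : Ideal A))
    (hxm : ∀ p : Ideal A, p.IsPrime → x ∈ p → p.IsMaximal) {M : Type*} [AddCommGroup M]
    [Module A M] : IsMCM A M ↔ Module.Finite A M ∧ IsSMulRegular M x := by
  have hmem (m : Ideal A) (hm : m.IsMaximal) : x ∈ m := (Ideal.mem_sInf.mp hxJ) ⟨bot_le, hm⟩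
  have hdepth (m : Ideal A) [hm : m.IsMaximal] : ringKrullDim (Localization.AtPrime m) ≤
        ((depth (Localization.AtPrime m) (LocalizedModule m.primeCompl M) : ℕ∞) : WithBot ℕ∞) ↔
      ∃ y ∈ IsLocalRing.maximalIdeal (Localization.AtPrime m),
        IsSMulRegular (LocalizedModule m.primeCompl M) y := by
    rw [ringKrullDim_localization_eq_one hx hxm m (hmem m hm), ← one_le_depth_iff]
    norm_cast
  unfold IsMCM
  refine and_congr_right fun hfin => ⟨fun h => ?_, fun h m hm => ?_⟩
  · refine isSMulRegular_iff_right_eq_zero_of_smul.mpr fun a ha => by_contra fun ha0 => ?_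
    obtain ⟨p, hp, hle⟩ := exists_le_isAssociatedPrime_of_isNoetherianRing A a ha0
    obtain ⟨hprime, b, rfl⟩ := isAssociatedPrime_iff.mp hp
    set p := (⊥ : Submodule A M).colon {b} with hpdef
    have hpm : p.IsMaximal := hxm p hprime (hle (by simpa [Submodule.mem_colon_singleton] using ha))
    obtain ⟨y, hy, hreg⟩ := (hdepth p).mp (h p)
    have hb0 : LocalizedModule.mkLinearMap p.primeCompl M b ≠ 0 := by
      intro h0
      obtain ⟨s, hs⟩ := (IsLocalizedModule.eq_zero_iff p.primeCompl
        (LocalizedModule.mkLinearMap p.primeCompl M)).mp h0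
      exact s.2 (Submodule.mem_colon_singleton.mpr ((Submodule.mem_bot A).mpr hs))
    refine hb0 (isSMulRegular_iff_right_eq_zero_of_smul.mp hreg _ ?_)
    have hmap : (IsLocalRing.maximalIdeal (Localization.AtPrime p)) ≤
        Ideal.torsionOf (Localization.AtPrime p) _ (LocalizedModule.mkLinearMap p.primeCompl M b) := by
      rw [← Localization.AtPrime.map_eq_maximalIdeal, Ideal.map_le_iff_le_comap]
      intro c hc
      rw [Ideal.mem_comap, Ideal.mem_torsionOf_iff, algebraMap_smul, ← map_smul,
        (Submodule.mem_bot A).mp (Submodule.mem_colon_singleton.mp hc), map_zero]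
    exact hmap hy
  · rw [hdepth m]
    refine ⟨algebraMap A _ x, ?_, ?_⟩
    · exact (IsLocalization.AtPrime.to_map_mem_maximal_iff _ m x).mpr (hmem m hm)
    · exact h.of_isLocalizedModule _ m.primeCompl (LocalizedModule.mkLinearMap m.primeCompl M)

end OneDimensional

/-! ### Fractional ideals and modules over the birational extension. -/

section Birational

open Module nonZeroDivisors

theorem mem_conductor {R : Type*} [CommRing R] {Q : Type*} [CommRing Q] [Algebra R Q]
    {S : Subalgebra R Q} {r : R} :
    r ∈ conductor S ↔ ∀ s ∈ S, algebraMap R Q r * s ∈ (algebraMap R Q).range := by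
  simp only [conductor, Submodule.mem_comap, Submodule.mem_div_iff_forall_mul_mem,
    Algebra.linearMap_apply, Submodule.mem_one, RingHom.mem_range, Subalgebra.mem_toSubmodule]

variable {R : Type u} [CommRing R] {Q : Type u} [CommRing Q] [Algebra R Q] [IsFractionRing R Q]

/-- Clearing denominators: a nonzerodivisor multiple of `s` lies in the image of `R`, and it is a
unit in `Q`. -/
theorem map_smul_of_birational {S : Subalgebra R Q} {M : Type*} [AddCommGroup M] [Module R M]
    [Module S M] [IsScalarTower R S M] (f : M →ₗ[R] Q) (s : S) (m : M) :
    f (s • m) = s * f m := by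
  obtain ⟨⟨a, b⟩, hab⟩ := IsLocalization.surj R⁰ (s : Q)
  have hs : (b : R) • s = algebraMap R S a := by
    ext
    simpa [Algebra.smul_def, mul_comm] using hab
  refine (IsLocalization.map_units Q b).mul_left_cancel ?_
  rw [← Algebra.smul_def, ← map_smul, ← smul_assoc, hs, algebraMap_smul, map_smul,
    Algebra.smul_def, ← hab]
  ring

theorem exists_mul_mem_range {I : Submodule R Q} (hI : I.FG) :
    ∃ d ∈ R⁰, ∀ i ∈ I, algebraMap R Q d * i ∈ (algebraMap R Q).range := by
  obtain ⟨d, hd, h⟩ := FractionalIdeal.isFractional_of_fg (S := R⁰) hI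
  refine ⟨d, hd, fun i hi => ?_⟩
  rw [← Algebra.smul_def]
  exact h i hi

/-- A reflexive fractional ideal is equal to its double inverse. -/
theorem mem_of_forall_mul_mem_range (I : Submodule R Q) [IsReflexive R I] (hI : I.FG) {u : Q}
    (hu : u ∈ I) (hu' : IsUnit u) {q : Q}
    (hq : ∀ t : Q, (∀ i ∈ I, t * i ∈ (algebraMap R Q).range) → q * t ∈ (algebraMap R Q).range) :
    q ∈ I := by
  have hinj : Function.Injective (algebraMap R Q) := IsFractionRing.injective R Q
  obtain ⟨v, hv⟩ := hu'.exists_left_inv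
  -- Every functional on `I` is multiplication by the fraction `f(u) / u`.
  have hf (f : Dual R I) (i : I) : algebraMap R Q (f i) = (algebraMap R Q (f ⟨u, hu⟩) * v) * i := by
    obtain ⟨⟨a, b⟩, hab⟩ := IsLocalization.surj R⁰ ((i : Q) * v)
    have hb := IsLocalization.map_units Q b
    have hi : (b : R) • i = a • (⟨u, hu⟩ : I) := by
      ext
      simp only [Submodule.coe_smul, Algebra.smul_def]
      rw [← hab]
      linear_combination (-(algebraMap R Q b) * i) * hv
    have := congrArg (fun z => algebraMap R Q (f z)) hi
    simp only [map_smul, smul_eq_mul, map_mul] at this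
    refine hb.mul_left_cancel ?_
    rw [this, ← hab]
    ring
  have hmem (f : Dual R I) : ∃ r : R, algebraMap R Q r = q * (algebraMap R Q (f ⟨u, hu⟩) * v) :=
    hq _ fun i hi => ⟨f ⟨i, hi⟩, hf f ⟨i, hi⟩⟩
  choose φ hφ using hmem
  -- Multiplication by `q` is a bidual element; reflexivity realizes it as evaluation at some `i ∈
  -- I`. The single functional `δ`, multiplication by a common denominator `d`, then gives `i = q`.
  let Φ : Dual R (Dual R I) :=
    { toFun := φ
      map_add' := fun f g => hinj (by simp only [map_add, hφ, LinearMap.add_apply]; ring)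
      map_smul' := fun c f => hinj (by
        simp only [map_mul, hφ, LinearMap.smul_apply, smul_eq_mul, RingHom.id_apply]; ring) }
  obtain ⟨i, hi⟩ := (bijective_dual_eval R I).2 Φ
  obtain ⟨d, hd, hdI⟩ := exists_mul_mem_range hI
  choose! ψ hψ using hdI
  let δ : Dual R I :=
    { toFun := fun i => ψ i
      map_add' := fun a b => hinj (by
        rw [map_add, hψ _ a.2, hψ _ b.2, hψ _ (a + b).2, Submodule.coe_add, mul_add])
      map_smul' := fun c a => hinj (by
        rw [RingHom.id_apply, smul_eq_mul, map_mul, hψ _ a.2, hψ _ (c • a).2, Submodule.coe_smul,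
          Algebra.smul_def]
        ring) }
  have h₁ : algebraMap R Q (δ i) = q * (algebraMap R Q (δ ⟨u, hu⟩) * v) := by
    rw [← hφ]
    exact congrArg _ (LinearMap.congr_fun hi δ)
  have hδu : algebraMap R Q (δ ⟨u, hu⟩) = algebraMap R Q d * u := hψ _ hu
  have hδi : algebraMap R Q (δ i) = algebraMap R Q d * i := hψ _ i.2
  rw [hδu, hδi] at h₁
  have hdu : IsUnit (algebraMap R Q d) := IsLocalization.map_units Q ⟨d, hd⟩
  have : (i : Q) = q := hdu.mul_left_cancel (by
    rw [h₁]; linear_combination (algebraMap R Q d * q) * hv)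
  exact this ▸ i.2

variable (S : Subalgebra R Q)

theorem exists_mem_conductor [Module.Finite R S] : ∃ d ∈ conductor S, d ∈ R⁰ := by
  obtain ⟨d, hd, h⟩ := exists_mul_mem_range (I := Subalgebra.toSubmodule S)
    (Module.Finite.iff_fg.mp ‹_›)
  exact ⟨d, mem_conductor.mpr h, hd⟩

theorem isFractionRing_subalgebra : IsFractionRing S Q where
  map_units s := by
    obtain ⟨⟨a, b⟩, hab⟩ := IsLocalization.surj R⁰ ((s : S) : Q)
    have ha : a ∈ R⁰ := by
      refine mem_nonZeroDivisors_iff_right.mpr fun r hr => ?_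
      have h₁ : algebraMap R S r * (s : S) = 0 := by
        refine Subtype.ext ((IsLocalization.map_units Q b).mul_left_cancel ?_)
        have := congrArg (algebraMap R Q) hr
        rw [map_mul, ← hab] at this
        simp only [map_zero] at this
        change _ * (algebraMap R Q r * ((s : S) : Q)) = _ * 0
        linear_combination this
      have h₂ := (mem_nonZeroDivisors_iff_right.mp s.2) _ h₁
      exact IsFractionRing.injective R Q (by simpa using congrArg Subtype.val h₂)
    have := IsLocalization.map_units Q ⟨a, ha⟩
    exact isUnit_of_mul_isUnit_left (y := algebraMap R Q b) (by rwa [← hab] at this)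
  surj q := by
    obtain ⟨⟨a, b⟩, hab⟩ := IsLocalization.surj R⁰ q
    refine ⟨⟨algebraMap R S a, ⟨algebraMap R S b, ?_⟩⟩, hab⟩
    refine mem_nonZeroDivisors_iff_right.mpr fun r hr => Subtype.ext ?_
    exact (IsLocalization.map_units Q b).mul_right_cancel
      ((congrArg Subtype.val hr).trans (zero_mul _).symm)
  exists_of_eq h := ⟨1, by rw [Subtype.ext h]⟩

theorem algebraMap_mem_nonZeroDivisors {x : R} (hx : x ∈ R⁰) : algebraMap R S x ∈ S⁰ :=
  mem_nonZeroDivisors_iff_right.mpr fun _ hr => Subtype.ext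
    ((IsLocalization.map_units Q ⟨x, hx⟩).mul_right_cancel
      ((congrArg Subtype.val hr).trans (zero_mul _).symm))

theorem algebraMap_mem_jacobson {R : Type*} [CommRing R] (S : Type*) [CommRing S]
    [Algebra R S] [IsLocalRing R] [Module.Finite R S] {x : R}
    (hx : x ∈ IsLocalRing.maximalIdeal R) : algebraMap R S x ∈ Ideal.jacobson (⊥ : Ideal S) := by
  refine Ideal.mem_sInf.mpr fun {m} hm => ?_
  have := hm.2
  have := Ideal.isMaximal_comap_of_isIntegral_of_isMaximal (R := R) m
  have h := IsLocalRing.eq_maximalIdeal this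
  exact Ideal.mem_comap.mp (h ▸ hx)

theorem isMaximal_of_algebraMap_mem {R : Type*} [CommRing R] (S : Type*) [CommRing S]
    [Algebra R S] [IsLocalRing R] (hdim : ringKrullDim R = 1)
    [Module.Finite R S] {x : R} (hx : x ∈ R⁰) (p : Ideal S) (hp : p.IsPrime)
    (hxp : algebraMap R S x ∈ p) : p.IsMaximal := by
  refine Ideal.isMaximal_of_isIntegral_of_isMaximal_comap (R := R) p ?_
  have hR : Ring.KrullDimLE 1 R := Order.krullDimLE_iff _ _ |>.mpr hdim.le
  refine (Ring.krullDimLE_one_iff.mp hR (p.comap (algebraMap R S)) inferInstance).resolve_left ?_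
  intro hmin
  exact Set.disjoint_left.mp (Ideal.disjoint_nonZeroDivisors_of_mem_minimalPrimes hmin)
    (Ideal.mem_comap.mpr hxp) hx

theorem isMCM_iff_isTorsionFree [IsLocalRing R] [IsNoetherianRing S] (hdim : ringKrullDim R = 1)
    [Module.Finite R S] {x : R} (hx : x ∈ R⁰) (hxm : x ∈ IsLocalRing.maximalIdeal R)
    {M : Type*} [AddCommGroup M] [Module R M] [Module S M] [IsScalarTower R S M] :
    IsMCM S M ↔ Module.Finite S M ∧ IsTorsionFree R M := by
  have key (y : R) (hy : y ∈ R⁰) (hym : y ∈ IsLocalRing.maximalIdeal R) :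
      IsMCM S M ↔ Module.Finite S M ∧ IsSMulRegular M y := by
    rw [isMCM_iff (algebraMap_mem_nonZeroDivisors S hy) (algebraMap_mem_jacobson S hym)
      (isMaximal_of_algebraMap_mem S hdim hy)]
    simp only [IsSMulRegular, algebraMap_smul]
  refine ⟨fun h => ⟨h.1, ⟨fun y hy => ?_⟩⟩, fun h => (key x hx hxm).mpr ⟨h.1, ?_⟩⟩
  · by_cases hym : y ∈ IsLocalRing.maximalIdeal R
    · exact ((key y hy.mem_nonZeroDivisors hym).mp h).2
    · have hu : IsUnit y := by simpa using hym
      exact hu.isSMulRegular M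
  · exact h.2.isSMulRegular (isRegular_iff_mem_nonZeroDivisors.mpr hx)

theorem isReflexive_of_isTorsionFree [IsLocalRing R] [IsNoetherianRing S]
    (hdim : ringKrullDim R = 1) (hS : IsGorensteinRing S) [Module.Finite R S] {x : R}
    (hx : x ∈ R⁰) (hxm : x ∈ IsLocalRing.maximalIdeal R)
    (M : Type u) [AddCommGroup M] [Module R M] [Module S M] [IsScalarTower R S M]
    [Module.Finite S M] [IsTorsionFree R M] : IsReflexive S M := by
  have hJ := algebraMap_mem_jacobson S hxm
  have hmax := isMaximal_of_algebraMap_mem S hdim hx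
  obtain ⟨n, hn⟩ := exists_hasInjectiveDimensionLE hS (finite_setOf_isMaximal hJ hmax)
  refine isReflexive_of_isSMulRegular (algebraMap_mem_nonZeroDivisors S hx) hJ hmax hn M ?_
  have : IsSMulRegular M x :=
    IsTorsionFree.isSMulRegular (isRegular_iff_mem_nonZeroDivisors.mpr hx)
  simpa only [IsSMulRegular, algebraMap_smul] using this

end Birational

/-! ### The conductor as a dual, and transfer of reflexivity from `S` to `R`. -/

section Conductor

open Module nonZeroDivisors

variable {R : Type u} [CommRing R] {Q : Type u} [CommRing Q] [Algebra R Q] [IsFractionRing R Q]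

theorem exists_linearMap_lift {M : Type*} [AddCommGroup M] [Module R M] (g : M →ₗ[R] Q)
    (hg : ∀ m, g m ∈ (algebraMap R Q).range) :
    ∃ f : M →ₗ[R] R, ∀ m, algebraMap R Q (f m) = g m := by
  have hinj : Function.Injective (algebraMap R Q) := IsFractionRing.injective R Q
  choose f hf using hg
  exact ⟨{ toFun := f
           map_add' := fun a b => hinj (by rw [map_add, hf, hf, hf, map_add])
           map_smul' := fun c a => hinj (by
            rw [RingHom.id_apply, smul_eq_mul, map_mul, hf, hf, map_smul, Algebra.smul_def]) }, hf⟩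

variable (S : Subalgebra R Q)

theorem algebraMap_apply_smul {S : Subalgebra R Q} {M : Type*} [AddCommGroup M] [Module R M]
    [Module S M] [IsScalarTower R S M] (f : M →ₗ[R] R) (s : S) (m : M) :
    algebraMap R Q (f (s • m)) = s * algebraMap R Q (f m) :=
  map_smul_of_birational (Algebra.linearMap R Q ∘ₗ f) s m

theorem apply_mem_conductor {S : Subalgebra R Q} {M : Type*} [AddCommGroup M] [Module R M]
    [Module S M] [IsScalarTower R S M] (f : M →ₗ[R] R) (m : M) : f m ∈ conductor S :=
  mem_conductor.mpr fun s hs => ⟨f ((⟨s, hs⟩ : S) • m), by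
    rw [algebraMap_apply_smul, mul_comm]⟩

/-- Evaluation at `1` identifies the dual of `S` with the conductor. -/
theorem nonempty_dual_equiv_conductor : Nonempty ((S →ₗ[R] R) ≃ₗ[R] conductor S) := by
  have hinj : Function.Injective (algebraMap R Q) := IsFractionRing.injective R Q
  let ev : (S →ₗ[R] R) →ₗ[R] conductor S :=
    (LinearMap.applyₗ (1 : S)).codRestrict (conductor S) fun f => apply_mem_conductor f 1
  have hev (f : S →ₗ[R] R) (s : S) : algebraMap R Q (f s) = s * algebraMap R Q (ev f) := by
    have := algebraMap_apply_smul f s 1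
    rwa [smul_eq_mul, mul_one] at this
  refine ⟨LinearEquiv.ofBijective ev ⟨fun f g hfg => ?_, fun c => ?_⟩⟩
  · exact LinearMap.ext fun s => hinj (by rw [hev, hev, hfg])
  · obtain ⟨f, hf⟩ := exists_linearMap_lift
      (c.1 • (Algebra.linearMap S Q).restrictScalars R) fun s => by
        simpa [Algebra.smul_def] using mem_conductor.mp c.2 s s.2
    refine ⟨f, Subtype.ext (hinj ?_)⟩
    exact (hf 1).trans (by simp [Algebra.smul_def])

/-- If `S` is reflexive, then it is the endomorphism ring of the conductor. -/
theorem nonempty_equiv_end_conductor [Module.Finite R S] [IsReflexive R S] :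
    Nonempty (S ≃ₗ[R] (conductor S →ₗ[R] conductor S)) := by
  have hinj : Function.Injective (algebraMap R Q) := IsFractionRing.injective R Q
  obtain ⟨d, hd, hd'⟩ := exists_mem_conductor S
  have hu : IsUnit (algebraMap R Q d) := IsLocalization.map_units Q ⟨d, hd'⟩
  obtain ⟨v, hv⟩ := hu.exists_left_inv
  have hg (g : conductor S →ₗ[R] conductor S) (c : conductor S) :
      algebraMap R Q (g c) = (algebraMap R Q (g ⟨d, hd⟩) * v) * algebraMap R Q c := by
    have h₁ : d • g c = c.1 • g ⟨d, hd⟩ := by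
      rw [← map_smul, ← map_smul]
      exact congrArg g (Subtype.ext (mul_comm _ _))
    have h₂ := congrArg (fun z : conductor S => algebraMap R Q z) h₁
    simp only [Submodule.coe_smul, smul_eq_mul, map_mul] at h₂
    linear_combination v * h₂ - algebraMap R Q (g c) * hv
  have hmem (g : conductor S →ₗ[R] conductor S) :
      algebraMap R Q (g ⟨d, hd⟩) * v ∈ Subalgebra.toSubmodule S := by
    have : IsReflexive R (Subalgebra.toSubmodule S) := ‹IsReflexive R S›
    refine mem_of_forall_mul_mem_range _ (Module.Finite.iff_fg.mp ‹Module.Finite R S›)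
      -- The fractions carrying `S` into `R` are exactly the elements of the conductor, and
      -- multiplication by `g(d) / d` maps these into `R`; so `g(d) / d` lies in the double inverse
      -- of `S`.
      (u := 1) S.one_mem isUnit_one fun t ht => ?_
    obtain ⟨r, hr⟩ := ht 1 S.one_mem
    rw [mul_one] at hr
    have hrc : r ∈ conductor S := mem_conductor.mpr fun s hs => hr ▸ ht s hs
    exact ⟨g ⟨r, hrc⟩, by rw [hg, hr]⟩
  let ψ : (conductor S →ₗ[R] conductor S) →ₗ[R] S :=
    { toFun := fun g => ⟨algebraMap R Q (g ⟨d, hd⟩) * v, hmem g⟩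
      map_add' := fun g h => Subtype.ext (by simp [add_mul])
      map_smul' := fun r g => Subtype.ext (by simp [Algebra.smul_def, mul_assoc]) }
  refine ⟨(LinearEquiv.ofBijective ψ ⟨fun g h hgh => ?_, fun s => ?_⟩).symm⟩
  · refine LinearMap.ext fun c => Subtype.ext (hinj ?_)
    rw [hg, hg h, show algebraMap R Q (g ⟨d, hd⟩) * v = algebraMap R Q (h ⟨d, hd⟩) * v from
      congrArg Subtype.val hgh]
  · obtain ⟨f, hf⟩ := exists_linearMap_lift (M := conductor S)
      (LinearMap.mulLeft R (s : Q) ∘ₗ Algebra.linearMap R Q ∘ₗ (conductor S).subtype) fun c => by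
        simpa [mul_comm] using mem_conductor.mp c.2 s s.2
    have hf' (c : conductor S) : algebraMap R Q (f c) = s * algebraMap R Q c := hf c
    refine ⟨f.codRestrict (conductor S) fun c => mem_conductor.mpr fun t ht => ?_, ?_⟩
    · rw [hf', mul_right_comm, mul_comm, ← mul_assoc, mul_assoc]
      simpa [mul_comm, mul_left_comm] using mem_conductor.mp c.2 _ (S.mul_mem s.2 ht)
    · refine Subtype.ext ?_
      change algebraMap R Q (f ⟨d, hd⟩) * v = s
      rw [hf']
      linear_combination (s : Q) * hv

/-- If `S` is self-dual over `R`, then reflexivity over `S` implies reflexivity over `R`. -/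
theorem isReflexive_of_equiv_dual (e : S ≃ₗ[R] (S →ₗ[R] R)) (M : Type u) [AddCommGroup M]
    [Module R M] [Module S M] [IsScalarTower R S M] [IsReflexive S M] : IsReflexive R M := by
  have hinj : Function.Injective (algebraMap R Q) := IsFractionRing.injective R Q
  have he (s t : S) : e s t = e 1 (s * t) := by
    have h₁ := algebraMap_apply_smul (S := S) (LinearMap.applyₗ t ∘ₗ e.toLinearMap) s 1
    have h₂ := algebraMap_apply_smul (S := S) (e 1) s t
    simp only [smul_eq_mul, mul_one] at h₁ h₂
    exact hinj (h₁.trans h₂.symm)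
  -- Hom-tensor adjunction: an `R`-functional on `N` is an `S`-map to `Hom_R(S, R) ≅ S`, followed by
  -- the generating form `e 1`.
  have lift (N : Type u) [AddCommGroup N] [Module R N] [Module S N] [IsScalarTower R S N]
      (g : N →ₗ[R] R) : ∃ g' : N →ₗ[S] S, ∀ n, e 1 (g' n) = g n := by
    let T (n : N) : S →ₗ[R] R := g ∘ₗ (LinearMap.toSpanSingleton S N n).restrictScalars R
    have hT (n : N) (t : S) : T n t = g (t • n) := rfl
    refine ⟨{ toFun := fun n => e.symm (T n)
              map_add' := fun a b => ?_
              map_smul' := fun s a => ?_ }, fun n => ?_⟩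
    · refine e.injective (LinearMap.ext fun t => ?_)
      simp [hT]
    · refine e.injective (LinearMap.ext fun t => ?_)
      rw [e.apply_symm_apply, RingHom.id_apply, he, smul_eq_mul, mul_assoc, mul_left_comm, ← he,
        e.apply_symm_apply, hT, hT, mul_comm, mul_smul]
    · have := he (e.symm (T n)) 1
      rw [mul_one, e.apply_symm_apply, hT, one_smul] at this
      exact this.symm
  refine ⟨⟨?_, fun Φ => ?_⟩⟩
  · rw [injective_iff_map_eq_zero]
    intro m hm
    refine (bijective_dual_eval S M).1 (LinearMap.ext fun f => ?_)
    refine e.injective (LinearMap.ext fun t => ?_)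
    have h := LinearMap.congr_fun hm ((e 1) ∘ₗ f.restrictScalars R ∘ₗ
      (LinearMap.lsmul S M t).restrictScalars R)
    simp only [Dual.eval_apply, LinearMap.comp_apply, LinearMap.restrictScalars_apply,
      LinearMap.lsmul_apply, map_smul, smul_eq_mul, LinearMap.zero_apply] at h
    rw [he, mul_comm]
    simpa using h
  · let g : Dual S M →ₗ[R] R := Φ ∘ₗ
      { toFun := fun f => (e 1) ∘ₗ f.restrictScalars R
        map_add' := fun f h => by ext; simp
        map_smul' := fun c f => by ext; simp }
    obtain ⟨Ψ, hΨ⟩ := lift (Dual S M) g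
    obtain ⟨m, hm⟩ := (bijective_dual_eval S M).2 Ψ
    refine ⟨m, LinearMap.ext fun h => ?_⟩
    obtain ⟨f, hf⟩ := lift M h
    have h₁ : h = (e 1) ∘ₗ f.restrictScalars R := LinearMap.ext fun n => (hf n).symm
    have h₂ := hΨ f
    rw [← hm] at h₂
    calc Dual.eval R M m h = e 1 (f m) := (hf m).symm
      _ = Φ ((e 1) ∘ₗ f.restrictScalars R) := h₂
      _ = Φ h := by rw [← h₁]

end Conductor

/-! ### Invertibility of the conductor and the `S`-structure on reflexive modules. -/

section Characterization

open Module nonZeroDivisors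

variable {R : Type u} [CommRing R] {Q : Type u} [CommRing Q] [Algebra R Q] [IsFractionRing R Q]
  (S : Subalgebra R Q)

/-- If fractional ideals of `S` are reflexive over both `R` and `S`, and `S` is semilocal, then
the conductor is an invertible, hence principal, fractional ideal of `S`. -/
theorem exists_conductor_generator [Module.Finite R S] [IsNoetherianRing S]
    (hmax : {m : Ideal S | m.IsMaximal}.Finite)
    (hR : ∀ I : Submodule S Q, I.FG → IsReflexive R (I.restrictScalars R))
    (hS : ∀ I : Submodule S Q, I.FG → IsReflexive S I) :
    ∃ θ : Q, IsUnit θ ∧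
      ∀ q : Q, (∀ s ∈ S, q * s ∈ (algebraMap R Q).range) ↔ ∃ s ∈ S, q = s * θ := by
  have := isFractionRing_subalgebra S
  have fg_of_le (I : Submodule S Q) (hI : ∀ q ∈ I, q ∈ S) : I.FG := by
    have h : I ≤ LinearMap.range (Algebra.linearMap S Q) := fun q hq => ⟨⟨q, hI q hq⟩, rfl⟩
    rw [← Submodule.map_comap_eq_self h]
    exact (IsNoetherian.noetherian _).map _
  have fg_restrict (I : Submodule S Q) (hI : I.FG) : (I.restrictScalars R).FG := by
    have : Module.Finite S I := Module.Finite.iff_fg.mpr hI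
    exact Module.Finite.iff_fg.mp (Module.Finite.trans (R := R) S I)
  have mem_range_iff (q : Q) : q ∈ (algebraMap S Q).range ↔ q ∈ S :=
    ⟨fun ⟨s, hs⟩ => hs ▸ s.2, fun h => ⟨⟨q, h⟩, rfl⟩⟩
  obtain ⟨C, hC⟩ : ∃ C : Submodule S Q,
      ∀ q, q ∈ C ↔ ∀ s ∈ S, q * s ∈ (algebraMap R Q).range :=
   ⟨{ carrier := {q | ∀ s ∈ S, q * s ∈ (algebraMap R Q).range}
      add_mem' := fun ha hb s hs => by rw [add_mul]; exact add_mem (ha s hs) (hb s hs)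
      zero_mem' := fun s _ => by rw [zero_mul]; exact zero_mem _
      smul_mem' := fun t q hq s hs => by
        rw [Algebra.smul_def, mul_right_comm, mul_comm, ← mul_assoc, mul_assoc]
        simpa [mul_comm, mul_left_comm] using hq _ (S.mul_mem t.2 hs) }, fun _ => Iff.rfl⟩
  have hCR (q : Q) (hq : q ∈ C) : q ∈ (algebraMap R Q).range := by
    simpa using (hC q).mp hq 1 S.one_mem
  have hCS (q : Q) (hq : q ∈ C) : q ∈ S := by
    obtain ⟨r, rfl⟩ := hCR q hq
    exact S.algebraMap_mem r
  -- `J = (S : C)` is the candidate inverse of the conductor `C`.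
  obtain ⟨J, hJ⟩ : ∃ J : Submodule S Q, ∀ t, t ∈ J ↔ ∀ c ∈ C, t * c ∈ S :=
   ⟨{ carrier := {t | ∀ c ∈ C, t * c ∈ S}
      add_mem' := fun ha hb c hc => by rw [add_mul]; exact add_mem (ha c hc) (hb c hc)
      zero_mem' := fun c _ => by rw [zero_mul]; exact zero_mem _
      smul_mem' := fun t q hq c hc => by
        rw [Algebra.smul_def, mul_assoc]; exact S.mul_mem t.2 (hq c hc) }, fun _ => Iff.rfl⟩
  obtain ⟨d, hd, hd'⟩ := exists_mem_conductor S
  have hu : IsUnit (algebraMap R Q d) := IsLocalization.map_units Q ⟨d, hd'⟩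
  have huC : algebraMap R Q d ∈ C := (hC _).mpr (mem_conductor.mp hd)
  have h1J : (1 : Q) ∈ J := (hJ _).mpr fun c hc => by rw [one_mul]; exact hCS c hc
  have hCJ : ∀ q ∈ C * J, q ∈ S := fun q hq => by
    refine Submodule.mul_induction_on hq (fun c hc t ht => ?_) fun _ _ => add_mem
    rw [mul_comm]
    exact (hJ t).mp ht c hc
  have mem_S_of_mul_mem (q : Q) (hq : ∀ c ∈ C, q * c ∈ C) : q ∈ S := by
    have hone : ∀ q ∈ (1 : Submodule S Q), q ∈ S := fun q hq => by
      obtain ⟨s, rfl⟩ := Submodule.mem_one.mp hq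
      exact s.2
    have hone' : ∀ q ∈ S, q ∈ (1 : Submodule S Q) := fun q hq =>
      Submodule.mem_one.mpr ⟨⟨q, hq⟩, rfl⟩
    have hfg := fg_of_le 1 hone
    have := hR 1 hfg
    refine hone q (mem_of_forall_mul_mem_range ((1 : Submodule S Q).restrictScalars R)
      (fg_restrict _ hfg) (u := 1) (hone' 1 S.one_mem) isUnit_one fun t ht => ?_)
    exact hCR _ (hq t ((hC t).mpr fun s hs => ht s (hone' s hs)))
  have mem_C_of_mul_mem (q : Q) (hq : ∀ t ∈ J, q * t ∈ S) : q ∈ C := by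
    have hfg := fg_of_le C hCS
    have := hS C hfg
    refine mem_of_forall_mul_mem_range C hfg huC hu fun t ht => ?_
    exact (mem_range_iff _).mpr (hq t ((hJ t).mpr fun c hc => (mem_range_iff _).mp (ht c hc)))
  -- As `C * J` equals its double inverse, it suffices that `t C J ⊆ R` forces `t ∈ R`. Indeed `t J
  -- C ⊆ C`, so `t J ⊆ (C : C) = S` by `R`-reflexivity of `S`, so `t ∈ (S : J) = C ⊆ R` by
  -- `S`-reflexivity of `C`.
  have one_mem : (1 : Q) ∈ C * J := by
    have hfg := fg_of_le (C * J) hCJ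
    have := hR (C * J) hfg
    have huCJ : algebraMap R Q d ∈ C * J := by
      simpa using Submodule.mul_mem_mul huC h1J
    refine (Submodule.restrictScalars_mem R (C * J) _).mp <|
      mem_of_forall_mul_mem_range ((C * J).restrictScalars R) (fg_restrict _ hfg)
      ((Submodule.restrictScalars_mem R (C * J) _).mpr huCJ) hu fun t ht => ?_
    rw [one_mul]
    refine hCR t (mem_C_of_mul_mem t fun j hj => mem_S_of_mul_mem _ fun c hc =>
      (hC _).mpr fun s hs => ?_)
    have hcs : c * s ∈ C := by
      have := C.smul_mem ⟨s, hs⟩ hc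
      rwa [Algebra.smul_def, mul_comm] at this
    have hcsj : c * s * j ∈ C * J := Submodule.mul_mem_mul hcs hj
    have hmem := ht _ ((Submodule.restrictScalars_mem R (C * J) _).mpr hcsj)
    rwa [show t * j * c * s = t * (c * s * j) by ring]
  have hmul : C * J = 1 := by
    refine le_antisymm ?_ (Submodule.one_le.mpr one_mem)
    intro q hq
    exact Submodule.mem_one.mpr ⟨⟨q, hCJ q hq⟩, rfl⟩
  have hCfrac : IsFractional S⁰ C := FractionalIdeal.isFractional_of_fg (fg_of_le C hCS)
  have hJfrac : IsFractional S⁰ J := by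
    refine ⟨algebraMap R S d, algebraMap_mem_nonZeroDivisors S hd', fun t ht => ?_⟩
    refine ⟨⟨t * algebraMap R Q d, (hJ t).mp ht _ huC⟩, ?_⟩
    rw [Algebra.smul_def]
    exact mul_comm _ _
  let C' : FractionalIdeal S⁰ Q := ⟨C, hCfrac⟩
  let J' : FractionalIdeal S⁰ Q := ⟨J, hJfrac⟩
  have hinv : C' * J' = 1 := FractionalIdeal.coeToSubmodule_injective
    ((FractionalIdeal.coe_mul C' J').trans (hmul.trans FractionalIdeal.coe_one.symm))
  have hprin : C.IsPrincipal :=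
    FractionalIdeal.isPrincipal.of_finite_maximals_of_inv le_rfl hmax C' J' hinv
  obtain ⟨θ, hθ⟩ := hprin
  have hmem (q : Q) : q ∈ C ↔ ∃ s ∈ S, q = s * θ := by
    rw [hθ, Submodule.mem_span_singleton]
    exact ⟨fun ⟨s, hs⟩ => ⟨s, s.2, hs.symm⟩, fun ⟨s, hs, h⟩ => ⟨⟨s, hs⟩, h.symm⟩⟩
  refine ⟨θ, ?_, fun q => (hC q).symm.trans (hmem q)⟩
  -- `θ` divides the unit `d` of `Q`.
  obtain ⟨s, -, hs⟩ := (hmem _).mp huC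
  exact isUnit_of_mul_isUnit_right (hs ▸ hu)

theorem nonempty_equiv_conductor {θ : Q} (hθ : IsUnit θ)
    (h : ∀ q : Q, (∀ s ∈ S, q * s ∈ (algebraMap R Q).range) ↔ ∃ s ∈ S, q = s * θ) :
    Nonempty (S ≃ₗ[R] conductor S) := by
  have hinj : Function.Injective (algebraMap R Q) := IsFractionRing.injective R Q
  have hmem (s : S) : ∀ t ∈ S, (s * θ) * t ∈ (algebraMap R Q).range := (h _).mpr ⟨s, s.2, rfl⟩
  obtain ⟨f, hf⟩ := exists_linearMap_lift (LinearMap.mulRight R θ ∘ₗ S.val.toLinearMap)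
    fun s => by simpa using hmem s 1 S.one_mem
  have hf' (s : S) : algebraMap R Q (f s) = s * θ := hf s
  let g : S →ₗ[R] conductor S := f.codRestrict (conductor S) fun s =>
    mem_conductor.mpr (by rw [hf']; exact hmem s)
  refine ⟨LinearEquiv.ofBijective g ⟨fun s t hst => ?_, fun c => ?_⟩⟩
  · refine Subtype.ext (hθ.mul_right_cancel ?_)
    rw [← hf', ← hf', show f s = f t from congrArg Subtype.val hst]
  · obtain ⟨s, hs, hsc⟩ := (h _).mp (mem_conductor.mp c.2)
    exact ⟨⟨s, hs⟩, Subtype.ext (hinj ((hf' _).trans hsc.symm))⟩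

/-- A reflexive `R`-module whose trace ideal lies in the conductor of `S` is an `S`-module. -/
theorem exists_module_of_traceIdeal_le {M : Type*} [AddCommGroup M] [Module R M]
    [IsReflexive R M] (hM : traceIdeal R M ≤ conductor S) :
    ∃ _ : Module S M, IsScalarTower R S M := by
  have hinj : Function.Injective (algebraMap R Q) := IsFractionRing.injective R Q
  have hext (a b : M) (hab : ∀ f : Dual R M, algebraMap R Q (f a) = algebraMap R Q (f b)) :
      a = b := (bijective_dual_eval R M).1 (LinearMap.ext fun f => hinj (hab f))
  have hex (s : S) (m : M) :
      ∃ m' : M, ∀ f : Dual R M, algebraMap R Q (f m') = s * algebraMap R Q (f m) := by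
    obtain ⟨Φ, hΦ⟩ := exists_linearMap_lift
      (LinearMap.mulLeft R (s : Q) ∘ₗ Algebra.linearMap R Q ∘ₗ Dual.eval R M m) fun f => by
        have hfm : f m ∈ conductor S := hM (le_iSup (fun f : M →ₗ[R] R => LinearMap.range f) f
          (LinearMap.mem_range_self f m))
        simpa [mul_comm] using mem_conductor.mp hfm s s.2
    obtain ⟨m', rfl⟩ := (bijective_dual_eval R M).2 Φ
    exact ⟨m', hΦ⟩
  choose σ hσ using hex
  let inst : Module S M :=
    { smul := σ
      one_smul := fun m => hext _ _ fun f => by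
        change algebraMap R Q (f (σ _ _)) = _
        rw [hσ, S.coe_one, one_mul]
      mul_smul := fun s t m => hext _ _ fun f => by
        change algebraMap R Q (f (σ _ _)) = algebraMap R Q (f (σ _ (σ _ _)))
        rw [hσ, hσ, hσ, S.coe_mul, mul_assoc]
      smul_zero := fun s => hext _ _ fun f => by
        change algebraMap R Q (f (σ _ _)) = _
        rw [hσ, map_zero, map_zero, mul_zero]
      smul_add := fun s a b => hext _ _ fun f => by
        change algebraMap R Q (f (σ _ _)) = algebraMap R Q (f (σ _ _ + σ _ _))
        rw [map_add, map_add, hσ, hσ, hσ, map_add, map_add, mul_add]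
      add_smul := fun s t m => hext _ _ fun f => by
        change algebraMap R Q (f (σ _ _)) = algebraMap R Q (f (σ _ _ + σ _ _))
        rw [map_add, map_add, hσ, hσ, hσ, S.coe_add, add_mul]
      zero_smul := fun m => hext _ _ fun f => by
        change algebraMap R Q (f (σ _ _)) = _
        rw [hσ, map_zero, map_zero, S.coe_zero, zero_mul] }
  refine ⟨inst, ⟨fun r s m => hext _ _ fun f => ?_⟩⟩
  change algebraMap R Q (f (σ _ _)) = algebraMap R Q (f (r • σ _ _))
  rw [map_smul, hσ, smul_eq_mul, map_mul, hσ, S.coe_smul, Algebra.smul_def, mul_assoc]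

end Characterization

end BirationalExt

/-! ### The equivalences. -/

theorem corollary3p6 {R : Type u} [CommRing R] [IsLocalRing R]
    (hCM : BirationalExt.IsCohenMacaulayLocalRing R)
    (hdim : ringKrullDim R = 1)
    (hgen : BirationalExt.IsGenericallyGorenstein R)
    {Q : Type u} [CommRing Q] [Algebra R Q] [IsFractionRing R Q]
    (S : Subalgebra R Q) (hfin : Module.Finite R S)
    (hS : BirationalExt.IsGorensteinRing S) :
    List.TFAE [
      ∀ (M : Type u) [AddCommGroup M] [Module R M],
        BirationalExt.MemCM R S M → BirationalExt.MemRefl R M,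
      Nonempty (S ≃ₗ[R] (S →ₗ[R] R)),
      BirationalExt.MemRefl R S ∧ BirationalExt.IsStable (BirationalExt.conductor S),
      ∀ (M : Type u) [AddCommGroup M] [Module R M],
        BirationalExt.MemCM R S M ↔
          (BirationalExt.MemRefl R M ∧
            BirationalExt.traceIdeal R M ≤ BirationalExt.conductor S)] := by
  open BirationalExt Module nonZeroDivisors in
  have hSN : IsNoetherianRing S := hS.1
  have hdepth : 1 ≤ depth R R := by
    have h := hCM.2
    rw [hdim] at h
    have h' : depth R R = 1 := by exact_mod_cast h
    exact h'.ge
  obtain ⟨x, hxm, hxreg⟩ := one_le_depth_iff.mp hdepth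
  have hx : x ∈ R⁰ := mem_nonZeroDivisors_iff.mpr
    ⟨fun a ha => isSMulRegular_iff_right_eq_zero_of_smul.mp hxreg a ha,
      fun a ha => isSMulRegular_iff_right_eq_zero_of_smul.mp hxreg a (by rwa [smul_eq_mul, mul_comm])⟩
  have hmcm (M : Type u) [AddCommGroup M] [Module R M] [Module S M] [IsScalarTower R S M] :
      IsMCM S M ↔ Module.Finite S M ∧ IsTorsionFree R M :=
    isMCM_iff_isTorsionFree S hdim hx hxm
  have hQ : IsTorsionFree R Q := ⟨fun r hr a b hab =>
    (IsLocalization.map_units Q ⟨r, hr.mem_nonZeroDivisors⟩).mul_left_cancel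
      (by simpa [Algebra.smul_def] using hab)⟩
  have htf (I : Submodule S Q) : IsTorsionFree R I :=
    ⟨fun r hr a b hab => Subtype.ext (hQ.isSMulRegular hr (congrArg Subtype.val hab))⟩
  have hSCM : MemCM R S S :=
    ⟨inferInstance, inferInstance, (hmcm S).mpr ⟨inferInstance,
      ⟨fun r hr a b hab => Subtype.ext (hQ.isSMulRegular hr (congrArg Subtype.val hab))⟩⟩⟩
  tfae_have 1 → 2 := by
    intro h
    obtain ⟨θ, hθ, hθ'⟩ := exists_conductor_generator S
      (finite_setOf_isMaximal (algebraMap_mem_jacobson S hxm)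
        (isMaximal_of_algebraMap_mem S hdim hx))
      (fun I hI => by
        have : Module.Finite S I := Module.Finite.iff_fg.mpr hI
        exact (h I ⟨inferInstance, inferInstance, (hmcm I).mpr ⟨this, htf I⟩⟩).2)
      (fun I hI => by
        have : Module.Finite S I := Module.Finite.iff_fg.mpr hI
        have := htf I
        exact isReflexive_of_isTorsionFree S hdim hS hx hxm I)
    obtain ⟨e₁⟩ := nonempty_equiv_conductor S hθ hθ'
    obtain ⟨e₂⟩ := nonempty_dual_equiv_conductor S
    exact ⟨e₁.trans e₂.symm⟩
  tfae_have 2 → 1 := by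
    rintro ⟨e⟩ M _ _ ⟨_, _, hM⟩
    obtain ⟨_, _⟩ := (hmcm M).mp hM
    have := isReflexive_of_isTorsionFree S hdim hS hx hxm M
    exact ⟨Module.Finite.trans S M, isReflexive_of_equiv_dual S e M⟩
  tfae_have 2 → 3 := by
    intro h
    have hrefl : MemRefl R S := tfae_2_to_1 h S hSCM
    have := hrefl.2
    obtain ⟨e⟩ := h
    obtain ⟨e₁⟩ := nonempty_dual_equiv_conductor S
    obtain ⟨e₂⟩ := nonempty_equiv_end_conductor S
    exact ⟨hrefl, exists_mem_conductor S, ⟨(e.trans e₁).symm.trans e₂⟩⟩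
  tfae_have 3 → 2 := by
    rintro ⟨⟨-, hrefl⟩, -, ⟨e⟩⟩
    obtain ⟨e₁⟩ := nonempty_dual_equiv_conductor S
    obtain ⟨e₂⟩ := nonempty_equiv_end_conductor S
    exact ⟨e₂.trans (e.symm.trans e₁.symm)⟩
  tfae_have 1 → 4 := by
    intro h M _ _
    refine ⟨fun hM => ⟨h M hM, ?_⟩, ?_⟩
    · obtain ⟨_, _, -⟩ := hM
      refine iSup_le fun f => ?_
      rintro _ ⟨m, rfl⟩
      exact apply_mem_conductor f m
    · rintro ⟨⟨hMfin, hMrefl⟩, htr⟩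
      obtain ⟨i₁, i₂⟩ := exists_module_of_traceIdeal_le S htr
      -- Reflexive modules are torsion-free, and finiteness over `R` gives finiteness over `S`.
      exact ⟨i₁, i₂, (hmcm M).mpr ⟨Module.Finite.of_restrictScalars_finite R S M, inferInstance⟩⟩
  tfae_have 4 → 1 := fun h M _ _ hM => ((h M).mp hM).1
  tfae_finish
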